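/- A numerical semigroup is a subset $S\subset\mathbb N=\{0,1,2,\dots\}$ containing $0$, closed under addition, with finite complement. Its multiplicity is its smallest nonzero element; its embedding dimension $e(S)$ is the cardinality of its minimal generating set (the generating set of smallest cardinality). A well-parameterized curve in $\mathbb C^d$ is a germ of an analytic map $c:(\mathbb C,0)\to(\mathbb C^d,0)$ that is injective near $0$, and its semigroup is the set of all finite orders of vanishing $\operatorname{ord}_{t=0}(p\circ c)$, where $p$ ranges over the germs of analytic functions on $\mathbb C^d$ at $0$. The minimal embedding dimension of $S$ is the least $d$ such that $S$ is the semigroup of some well-parameterized curve in $\mathbb C^d$; $S$ is called planar if its minimal embedding dimension is $2$. **Corollary.** Let $S=\langle b_0,b_1,\dots,b_g\rangle$ be a numerical semigroup given by its minimal generating set, listed in increasing order $b_0<b_1<\dots<b_g$, so that $m=b_0$ is the multiplicity of $S$ and $e(S)=g+1$. If $S$ is planar, then $$e(S)=g+1\le 1+\Omega(m),$$ where $\Omega(m)$ is the number of prime factors of $m$ counted with multiplicity. -/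

import Mathlib

open scoped Topology

namespace CurveSemigroup

/-- A numerical semigroup: an additive submonoid of `ℕ` with finite complement. -/
def IsNumericalSemigroup (S : AddSubmonoid ℕ) : Prop :=
  ((S : Set ℕ)ᶜ).Finite

/-- `A` generates `S`, and has the smallest cardinality among the finite generating sets of `S`. -/
def IsMinimalGeneratingSet (S : AddSubmonoid ℕ) (A : Finset ℕ) : Prop :=
  AddSubmonoid.closure (A : Set ℕ) = S ∧
    ∀ B : Finset ℕ, AddSubmonoid.closure (B : Set ℕ) = S → A.card ≤ B.card

/-- The embedding dimension: the cardinality of a minimal generating set. -/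
noncomputable def embeddingDim (S : AddSubmonoid ℕ) : ℕ :=
  sInf {e : ℕ | ∃ A : Finset ℕ, IsMinimalGeneratingSet S A ∧ A.card = e}

/-- The multiplicity: the smallest nonzero element. -/
noncomputable def multiplicity (S : AddSubmonoid ℕ) : ℕ :=
  sInf {n : ℕ | n ∈ S ∧ n ≠ 0}

/-- `c` represents a well-parameterized analytic curve germ `(ℂ, 0) → (ℂ^d, 0)`: it is analytic
at `0`, sends `0` to `0`, and is one-to-one on a neighbourhood of `0` (so it is nonconstant). -/
structure IsWellParameterizedCurve {d : ℕ} (c : ℂ → (Fin d → ℂ)) : Prop where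
  analyticAt : AnalyticAt ℂ c 0
  map_zero : c 0 = 0
  injOn : ∃ U ∈ 𝓝 (0 : ℂ), Set.InjOn c U

/-- The semigroup of a curve `c` in `ℂ^d`: the finite orders of vanishing at `0` of the pullbacks
`p ∘ c`, where `p` runs through the functions on `ℂ^d` that are analytic at `0`. -/
def semigroupOfCurve {d : ℕ} (c : ℂ → (Fin d → ℂ)) : Set ℕ :=
  {n : ℕ | ∃ p : (Fin d → ℂ) → ℂ, AnalyticAt ℂ p 0 ∧ analyticOrderAt (p ∘ c) 0 = (n : ℕ∞)}

/-- `S` is the semigroup of some well-parameterized analytic curve germ in `ℂ^d`. -/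
def IsRealizedInDim (S : AddSubmonoid ℕ) (d : ℕ) : Prop :=
  ∃ c : ℂ → (Fin d → ℂ), IsWellParameterizedCurve c ∧ semigroupOfCurve c = (S : Set ℕ)

/-- The minimal embedding dimension: the least `d` such that `S` is the semigroup of a curve germ
in `ℂ^d`. -/
noncomputable def minimalEmbeddingDim (S : AddSubmonoid ℕ) : ℕ :=
  sInf {d : ℕ | IsRealizedInDim S d}

/-- A numerical semigroup is planar if its minimal embedding dimension is `2`. (The value `2` is
never the default value of `sInf`, so it is attained by a plane curve and not by a line.) -/
def IsPlanar (S : AddSubmonoid ℕ) : Prop :=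
  minimalEmbeddingDim S = 2

end CurveSemigroup

/-! Let a plane curve have semigroup `S` of multiplicity `m`. One of its coordinates, call it `x`,
has order exactly `m`; let `y` be the other. Truncating Taylor series shows that polynomials in `x,
y` already realize every element of `S`, so `S` is the set of finite values of the order valuation
`v` on `ℂ[X][Y]`.

Let `a j` be the largest value of a polynomial monic of degree `j` in `Y`. Multiplying monic
polynomials gives `a i + a j ≤ a (i + j)`. Two of these values are never congruent modulo `m`:
otherwise a multiple `z * X ^ k` of the lower optimal polynomial would cancel the leading term of
the higher one and raise its value. Hence `a 0, …, a (m - 1)` is a superadditive enumeration of the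
Apéry set of `S` (`exists_superadditive_apery`).

The rest is arithmetic (`exists_generators_of_superadditive`). Suppose `d * D = m` and `D` divides
`a i` for all `i < d`. Then `a d` is not divisible by `D`, and superadditivity forces `a (d * q + i)
= q * a d + a i` as long as the multiples of `a d` are distinct modulo `D`. So one new generator `a
d` replaces `D` by `gcd (D, a d)` and multiplies `d` by a factor greater than 1. At most `Ω m` such
steps lead from `d = 1` to `d = m`; the generator `m` itself is the extra one. -/

namespace CurveSemigroup

/-! ### Combinatorics of superadditive Apéry sequences -/

/-- If the residues of `a 0, …, a (d - 1)` modulo `d * D` are distinct multiples of `D`, the next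
term is not a multiple of `D`. -/
theorem not_dvd_of_modEq_injective {n d D : ℕ} {a : ℕ → ℕ} (hdD : d * D = n) (hd : d < n)
    (hinj : ∀ i < n, ∀ j < n, a i ≡ a j [MOD n] → i = j) (hD : ∀ i < d, D ∣ a i) : ¬ D ∣ a d := by
  intro h
  have hle : ∀ i ∈ Finset.range (d + 1), D ∣ a i := by
    intro i hi
    rcases Nat.lt_succ_iff_lt_or_eq.1 (Finset.mem_range.1 hi) with h' | rfl
    · exact hD i h'
    · exact h
  have hn : 0 < n := by omega
  have hDpos : 0 < D := Nat.pos_of_ne_zero (by rintro rfl; omega)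
  -- Pigeonhole: only `d` multiples of `D` lie below `n = d * D`, for `d + 1` indices.
  obtain ⟨i, hi, j, hj, hij, he⟩ := Finset.exists_ne_map_eq_of_card_lt_of_maps_to
    (s := Finset.range (d + 1)) (t := Finset.range d) (f := fun i => a i % n / D) (by simp)
    (by
      intro i hi
      simp only [Finset.coe_range, Set.mem_Iio]
      rw [Nat.div_lt_iff_lt_mul hDpos, hdD]
      exact Nat.mod_lt _ hn)
  have hdvd : ∀ i ∈ Finset.range (d + 1), D ∣ a i % n := fun i hi =>
    (Nat.dvd_mod_iff (Dvd.intro_left d hdD)).2 (hle i hi)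
  have hmod : a i % n = a j % n := by
    rw [← Nat.div_mul_cancel (hdvd i hi), ← Nat.div_mul_cancel (hdvd j hj)]
    exact congrArg (· * D) he
  rw [Finset.mem_range] at hi hj
  exact hij (hinj i (by omega) j (by omega) hmod)

theorem strictMono_of_superadditive {n : ℕ} {a : ℕ → ℕ}
    (hinj : ∀ i < n, ∀ j < n, a i ≡ a j [MOD n] → i = j)
    (hsup : ∀ i j, i + j < n → a i + a j ≤ a (i + j)) {i j : ℕ} (hij : i < j) (hj : j < n) :
    a i < a j := by
  have h := hsup i (j - i) (by omega)
  rw [Nat.add_sub_cancel' hij.le] at h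
  refine lt_of_le_of_ne (by omega) fun he => hij.ne (hinj i (by omega) j hj ?_)
  rw [he]

/-- The block structure of a superadditive Apéry sequence. -/
theorem superadditive_block {n d D : ℕ} {a : ℕ → ℕ} (hd0 : 0 < d) (hdD : d * D = n)
    (hinj : ∀ i < n, ∀ j < n, a i ≡ a j [MOD n] → i = j)
    (hsup : ∀ i j, i + j < n → a i + a j ≤ a (i + j))
    (hadd : ∀ i < n, ∀ j < n, ∃ l < n, ∃ k, a i + a j = a l + n * k)
    (hD : ∀ i < d, D ∣ a i) (hDpos : 0 < D) (hdn : d < n) :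
    ∀ q < D / D.gcd (a d), ∀ i < d, a (d * q + i) = q * a d + a i := by
  -- `e` is the order of `a d` in `ℤ/D`.
  set e := D / D.gcd (a d) with he
  have hgpos : 0 < D.gcd (a d) := Nat.gcd_pos_of_pos_left _ hDpos
  have heD : e * D.gcd (a d) = D := Nat.div_mul_cancel (Nat.gcd_dvd_left _ _)
  have hlt : ∀ q < e, ∀ i < d, d * q + i < n := by
    intro q hq i hi
    have h1 : d * (q + 1) ≤ d * D :=
      Nat.mul_le_mul le_rfl (hq.trans_le (Nat.div_le_self _ _))
    rw [mul_add] at h1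
    omega
  -- Modulo `D` the terms `a i` vanish, so `q` is determined because it is below the order of `a d`;
  -- then `i` is determined modulo `n`.
  have hcancel : ∀ q < e, ∀ q' < e, ∀ i < d, ∀ i' < d,
      q * a d + a i ≡ q' * a d + a i' [MOD n] → q = q' ∧ i = i' := by
    intro q hq q' hq' i hi i' hi' h
    have h1 : q * a d ≡ q' * a d [MOD D] := by
      have h2 := h.of_dvd (Dvd.intro_left d hdD)
      have z : ∀ i < d, a i ≡ 0 [MOD D] := fun i hi => (Nat.modEq_zero_iff_dvd).2 (hD i hi)
      exact Nat.ModEq.add_right_cancel ((z i hi).trans (z i' hi').symm) h2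
    have h3 : q = q' := by
      have := Nat.ModEq.cancel_right_div_gcd hDpos h1
      exact Nat.ModEq.eq_of_lt_of_lt this hq hq'
    subst h3
    exact ⟨rfl, hinj i (by omega) i' (by omega) (Nat.ModEq.add_left_cancel' _ h)⟩
  suffices H : ∀ m, ∀ q < e, ∀ i < d, d * q + i = m → a (d * q + i) = q * a d + a i from
    fun q hq i hi => H _ q hq i hi rfl
  intro m
  induction m using Nat.strong_induction_on with
  | _ m ih =>
    rintro (_ | q) hq i hi rfl
    · simp
    have hqi := hlt (q + 1) hq i hi
    have hlow := hlt q (by omega) i hi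
    have e1 : d * (q + 1) + i = (d * q + i) + d := by ring
    have e2 : (q + 1) * a d + a i = a (d * q + i) + a d := by
      rw [ih _ (by omega) q (by omega) i hi rfl]; ring
    rw [e2]
    have hle : a (d * q + i) + a d ≤ a (d * (q + 1) + i) := by
      rw [e1]; exact hsup _ _ (by omega)
    -- The sum has an Apéry representative `a l`. Superadditivity and monotonicity bound `l` by the
    -- expected index. A smaller `l` is covered by induction and contradicts `hcancel`; equality
    -- leaves no room for `k > 0`.
    obtain ⟨l, hl, k, hk⟩ := hadd _ hlow d hdn
    have hl1 : l ≤ d * (q + 1) + i := by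
      by_contra hc
      have := strictMono_of_superadditive hinj hsup (not_le.1 hc) hl
      omega
    have hl2 : l = d * (q + 1) + i := by
      by_contra hc
      have hll : l < d * (q + 1) + i := lt_of_le_of_ne hl1 hc
      have hmd : d * (l / d) + l % d = l := Nat.div_add_mod l d
      have hmd' : l % d < d := Nat.mod_lt _ hd0
      have hql : l / d ≤ q + 1 := by
        rw [Nat.le_iff_lt_add_one, Nat.div_lt_iff_lt_mul hd0]
        have : (q + 1 + 1) * d = d * (q + 1) + d := by ring
        omega
      have hal : a l = l / d * a d + a (l % d) := by
        have h4 := ih l hll (l / d) (by omega) (l % d) hmd' hmd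
        rwa [hmd] at h4
      have hm : (q + 1) * a d + a i ≡ l / d * a d + a (l % d) [MOD n] := by
        rw [e2, hk, ← hal]
        simp [Nat.ModEq]
      obtain ⟨h5, h6⟩ := hcancel _ hq _ (by omega) _ hi _ hmd' hm
      rw [← h5, ← h6] at hmd
      exact hc hmd.symm
    subst hl2
    omega

/-- A semigroup whose Apéry set with respect to `n`, suitably enumerated, is superadditive, is
generated by at most `1 + Ω n` elements. -/
theorem exists_generators_of_superadditive {n : ℕ} (S : AddSubmonoid ℕ) {a : ℕ → ℕ}
    (hn : 0 < n) (ha0 : a 0 = 0)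
    (hinj : ∀ i < n, ∀ j < n, a i ≡ a j [MOD n] → i = j)
    (hsup : ∀ i j, i + j < n → a i + a j ≤ a (i + j))
    (hS : ∀ s, s ∈ S ↔ ∃ i < n, ∃ k, s = a i + n * k) :
    ∃ B : Finset ℕ, AddSubmonoid.closure (B : Set ℕ) = S ∧
      B.card ≤ 1 + ArithmeticFunction.cardFactors n := by
  have haS : ∀ i < n, a i ∈ S := fun i hi => (hS _).2 ⟨i, hi, 0, by simp⟩
  have hadd : ∀ i < n, ∀ j < n, ∃ l < n, ∃ k, a i + a j = a l + n * k := fun i hi j hj =>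
    (hS _).1 (S.add_mem (haS i hi) (haS j hj))
  -- Invariant of the descent on `D`: the first `d` terms are multiples of `D` and are generated by
  -- at most `Ω d` elements. It starts at `d = 1`, `D = n`; the generator `n` is added only at the
  -- end.
  suffices H : ∀ D d, 0 < D → 0 < d → d * D = n → (∀ i < d, D ∣ a i) →
      ∀ B : Finset ℕ, (∀ x ∈ B, x ∈ S) → (∀ i < d, a i ∈ AddSubmonoid.closure (B : Set ℕ)) →
      B.card ≤ ArithmeticFunction.cardFactors d →
      ∃ B : Finset ℕ, (∀ x ∈ B, x ∈ S) ∧ (∀ i < n, a i ∈ AddSubmonoid.closure (B : Set ℕ)) ∧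
      B.card ≤ ArithmeticFunction.cardFactors n by
    obtain ⟨B, hBS, hB, hc⟩ := H n 1 hn one_pos (one_mul n)
      (fun i hi => by rw [Nat.lt_one_iff.1 hi, ha0]; exact dvd_zero n) ∅ (by simp)
      (fun i hi => by rw [Nat.lt_one_iff.1 hi, ha0]; exact zero_mem _) (by simp)
    refine ⟨insert n B, le_antisymm ?_ ?_, (Finset.card_insert_le _ _).trans (by omega)⟩
    · rw [AddSubmonoid.closure_le]
      intro x hx
      rcases Finset.mem_insert.1 (Finset.mem_coe.1 hx) with rfl | hx
      · exact (hS _).2 ⟨0, hn, 1, by simp [ha0]⟩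
      · exact hBS x hx
    · intro s hs
      obtain ⟨i, hi, k, rfl⟩ := (hS s).1 hs
      refine add_mem (AddSubmonoid.closure_mono (by simp) (hB i hi)) ?_
      rw [mul_comm, ← smul_eq_mul]
      exact nsmul_mem (AddSubmonoid.subset_closure (by simp)) k
  intro D
  induction D using Nat.strong_induction_on with
  | _ D ih =>
    intro d hD hd hdD hdvd B hBS hB hc
    rcases Nat.lt_or_ge d n with hdn | hdn
    · have hnd := not_dvd_of_modEq_injective hdD hdn hinj hdvd
      have hblock := superadditive_block hd hdD hinj hsup hadd hdvd hD hdn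
      set G := D.gcd (a d) with hG
      have hGpos : 0 < G := Nat.gcd_pos_of_pos_left _ hD
      have hGD : D / G * G = D := Nat.div_mul_cancel (Nat.gcd_dvd_left _ _)
      have hGlt : G < D := lt_of_le_of_ne (Nat.gcd_le_left _ hD) fun h =>
        hnd (h ▸ Nat.gcd_dvd_right D (a d))
      have he : 1 < D / G := by
        by_contra h
        have : D / G * G ≤ 1 * G := Nat.mul_le_mul_right _ (not_lt.1 h)
        omega
      have hdecomp : ∀ i < d * (D / G), a i = i / d * a d + a (i % d) := by
        intro i hi
        have := hblock (i / d) (Nat.div_lt_of_lt_mul hi) (i % d) (Nat.mod_lt _ hd)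
        rwa [Nat.div_add_mod] at this
      refine ih G hGlt (d * (D / G)) hGpos (Nat.mul_pos hd (by omega))
        (by rw [mul_assoc, hGD, hdD]) ?_ (insert (a d) B) ?_ ?_ ?_
      · intro i hi
        rw [hdecomp i hi]
        exact dvd_add (Dvd.dvd.mul_left (Nat.gcd_dvd_right _ _) _)
          ((Nat.gcd_dvd_left _ _).trans (hdvd _ (Nat.mod_lt _ hd)))
      · intro x hx
        rcases Finset.mem_insert.1 hx with rfl | hx
        · exact haS d hdn
        · exact hBS x hx
      · intro i hi
        rw [hdecomp i hi, ← smul_eq_mul]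
        exact add_mem (nsmul_mem (AddSubmonoid.subset_closure (by simp)) _)
          (AddSubmonoid.closure_mono (by simp) (hB _ (Nat.mod_lt _ hd)))
      · rw [ArithmeticFunction.cardFactors_mul hd.ne' (by omega)]
        have : 0 < ArithmeticFunction.cardFactors (D / G) := by
          rw [Nat.pos_iff_ne_zero, Ne, ArithmeticFunction.cardFactors_eq_zero_iff_eq_zero_or_one]
          omega
        exact (Finset.card_insert_le _ _).trans (by omega)
    · have hdn' : d = n := le_antisymm (hdD ▸ Nat.le_mul_of_pos_right d hD) hdn
      subst hdn'
      exact ⟨B, hBS, hB, hc⟩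

/-! ### Optimal monic polynomials for a valuation of `K[X][Y]` -/

open Polynomial in
/-- The values of a valuation on `K[X]`, embedded into `K[X][Y]`, that is positive on `X`. -/
theorem addValuation_C {K : Type*} [Field K] (v : AddValuation K[X][X] ℕ∞)
    (hconst : ∀ z : K, z ≠ 0 → v (C (C z)) = 0) {n : ℕ} (hn : 0 < n) (hX : v (C X) = n)
    (p : K[X]) (hp : p ≠ 0) : ∃ k : ℕ, v (C p) = ((n * k : ℕ) : ℕ∞) := by
  obtain ⟨q, hq, hdvd⟩ := exists_eq_pow_rootMultiplicity_mul_and_not_dvd p hp 0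
  rw [C_0, sub_zero] at hq hdvd
  refine ⟨rootMultiplicity 0 p, ?_⟩
  have h0 : q.coeff 0 ≠ 0 := fun h => hdvd (X_dvd_iff.2 h)
  -- `q` has a nonzero constant term, which dominates since `X` has positive value.
  have hv : v (C q) = 0 := by
    rw [← hconst _ h0]
    conv_lhs => rw [← divX_mul_X_add q]
    rw [C_add]
    apply v.map_add_eq_of_lt_right
    rw [hconst _ h0, C_mul, v.map_mul, hX]
    exact lt_of_lt_of_le (by exact_mod_cast hn) le_add_self
  rw [hq, C_mul, v.map_mul, hv, C_pow, v.map_pow, hX, ← hq]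
  simp [mul_comm]

section Approximants

open Polynomial

variable {K : Type*} [Field K]

/-- `f` is monic of degree `j`, and has the largest value `a` among such polynomials. -/
structure IsOptimal (v : AddValuation K[X][X] ℕ∞) (j a : ℕ) (f : K[X][X]) : Prop where
  monic : f.Monic
  natDegree_eq : f.natDegree = j
  value_eq : v f = a
  value_le : ∀ g : K[X][X], g.Monic → g.natDegree = j → v g ≤ a

/-- The values of the monic polynomials of degree `j` are unbounded. -/
def Unbounded (v : AddValuation K[X][X] ℕ∞) (j : ℕ) : Prop :=
  ∀ k : ℕ, ∃ f : K[X][X], f.Monic ∧ f.natDegree = j ∧ (k : ℕ∞) < v f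

variable {v : AddValuation K[X][X] ℕ∞}

theorem exists_isOptimal {j : ℕ} (h : ¬ Unbounded v j) : ∃ a f, IsOptimal v j a f := by
  classical
  simp only [Unbounded, not_forall, not_exists, not_and, not_lt] at h
  obtain ⟨k, hk⟩ := h
  have hP : ∃ a : ℕ, a ≤ k ∧ ∃ f : K[X][X], f.Monic ∧ f.natDegree = j ∧ v f = a := by
    have h1 := hk (X ^ j) (monic_X_pow j) (natDegree_X_pow j)
    obtain ⟨a, ha, hak⟩ := ENat.le_natCast_iff.1 h1
    exact ⟨a, hak, X ^ j, monic_X_pow j, natDegree_X_pow j, ha⟩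
  obtain ⟨a0, ha0k, ha0⟩ := hP
  obtain ⟨f, hf1, hf2, hf3⟩ := Nat.findGreatest_spec
    (P := fun a : ℕ => ∃ f : K[X][X], f.Monic ∧ f.natDegree = j ∧ v f = a) ha0k ha0
  refine ⟨_, f, hf1, hf2, hf3, fun g hg hgj => ?_⟩
  obtain ⟨a, ha, hak⟩ := ENat.le_natCast_iff.1 (hk g hg hgj)
  rw [ha, Nat.cast_le]
  refine Nat.le_findGreatest hak ?_
  exact ⟨g, hg, hgj, ha⟩

theorem IsOptimal.add_le {i j a b c : ℕ} {f g h : K[X][X]} (hf : IsOptimal v i a f)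
    (hg : IsOptimal v j b g) (hh : IsOptimal v (i + j) c h) : a + b ≤ c := by
  have := hh.value_le (f * g) (hf.monic.mul hg.monic)
    (by rw [hf.monic.natDegree_mul hg.monic, hf.natDegree_eq, hg.natDegree_eq])
  rw [v.map_mul, hf.value_eq, hg.value_eq] at this
  exact_mod_cast this

/-- Multiplying by a power of `Y` gives a competitor of degree `j`, and no value is negative. -/
theorem IsOptimal.le {i j a b : ℕ} {f g : K[X][X]} (hf : IsOptimal v i a f)
    (hg : IsOptimal v j b g) (hij : i ≤ j) : a ≤ b := by
  have := hg.value_le (f * X ^ (j - i)) (hf.monic.mul (monic_X_pow _))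
    (by rw [hf.monic.natDegree_mul (monic_X_pow _), hf.natDegree_eq, natDegree_X_pow]; omega)
  rw [v.map_mul, hf.value_eq] at this
  exact_mod_cast le_self_add.trans this

theorem IsOptimal.eq_zero {a : ℕ} {f : K[X][X]} (hf : IsOptimal v 0 a f) : a = 0 := by
  have h := hf.value_eq
  rw [eq_one_of_monic_natDegree_zero hf.monic hf.natDegree_eq, v.map_one] at h
  exact_mod_cast h.symm

/-- If the values were congruent, a power of `X` would lift `f` to the value of `g`. By `hres`,
subtracting a constant multiple then raises the value of `g`, and `i < j` keeps the difference monic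
of degree `j`, against optimality. -/
theorem IsOptimal.not_modEq {n : ℕ} (hX : v (C X) = n)
    (hres : ∀ (p q : K[X][X]) (k : ℕ), v p = k → v q = k → ∃ z : K, (k : ℕ∞) < v (p - C (C z) * q))
    {i j a b : ℕ} {f g : K[X][X]} (hf : IsOptimal v i a f)
    (hg : IsOptimal v j b g) (hij : i < j) : ¬ a ≡ b [MOD n] := by
  intro h
  have hab := hf.le hg hij.le
  obtain ⟨k, hk⟩ := (Nat.modEq_iff_dvd' hab).1 h
  have hval : v (C X ^ k * f) = b := by
    rw [v.map_mul, v.map_pow, hX, hf.value_eq, nsmul_eq_mul]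
    norm_cast
    rw [mul_comm, ← hk]
    omega
  obtain ⟨z, hz⟩ := hres g _ b hg.value_eq hval
  have hdeg : (C (C z) * (C X ^ k * f)).degree < g.degree := by
    have e : C (C z) * (C X ^ k * f) = C (C z * X ^ k) * f := by
      rw [C_mul, C_pow]; ring
    rw [e]
    refine lt_of_le_of_lt (b := f.degree) ?_ ?_
    · refine (degree_mul_le _ _).trans ?_
      have := add_le_add_left (degree_C_le (a := C z * X ^ k)) f.degree
      simpa using this
    · rw [degree_eq_natDegree hf.monic.ne_zero, degree_eq_natDegree hg.monic.ne_zero,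
        hf.natDegree_eq, hg.natDegree_eq]
      exact_mod_cast hij
  have := hg.value_le _ (hg.monic.sub_of_left hdeg)
    (by rw [natDegree_eq_of_degree_eq (degree_sub_eq_left_of_degree_lt hdeg), hg.natDegree_eq])
  exact absurd hz (not_lt.2 this)

/-- Polynomials of degree less than `j` take values in the classes of the optimal values. -/
theorem exists_value_of_degree_lt (hconst : ∀ z : K, z ≠ 0 → v (C (C z)) = 0) {n : ℕ}
    (hn : 0 < n) (hX : v (C X) = n)
    (hres : ∀ (p q : K[X][X]) (k : ℕ), v p = k → v q = k → ∃ z : K, (k : ℕ∞) < v (p - C (C z) * q))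
    {N : ℕ} {a : ℕ → ℕ} {f : ℕ → K[X][X]} (hf : ∀ j < N, IsOptimal v j (a j) (f j)) :
    ∀ j ≤ N, ∀ p : K[X][X], p ≠ 0 → p.degree < j →
      ∃ i < j, ∃ k, v p = ((a i + n * k : ℕ) : ℕ∞) := by
  intro j
  induction j with
  | zero =>
    intro _ p hp h
    exact absurd (degree_eq_bot.1 (Nat.WithBot.lt_zero_iff.1 h)) hp
  | succ j ih =>
    intro hj p hp hdeg
    have hopt := hf j (by omega)
    have hpj : p.degree ≤ j := (degree_le_iff_coeff_zero p j).2 fun l hl =>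
      coeff_eq_zero_of_degree_lt (hdeg.trans_le (by
        have : j < l := by exact_mod_cast hl
        exact_mod_cast this))
    by_cases hc : p.coeff j = 0
    · have hlt : p.degree < j := lt_of_le_of_ne hpj fun h =>
        coeff_ne_zero_of_eq_degree h hc
      obtain ⟨i, hi, k, hk⟩ := ih (by omega) p hp hlt
      exact ⟨i, by omega, k, hk⟩
    obtain ⟨l, hl⟩ := addValuation_C v hconst hn hX _ hc
    have hvf : v (C (p.coeff j) * f j) = ((a j + n * l : ℕ) : ℕ∞) := by
      rw [v.map_mul, hl, hopt.value_eq, add_comm]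
      norm_cast
    have hfdeg : (f j).degree = j := by
      rw [degree_eq_natDegree hopt.monic.ne_zero, hopt.natDegree_eq]
    have hrdeg : (p - C (p.coeff j) * f j).degree < j := by
      rw [degree_lt_iff_coeff_zero]
      intro m hm
      rcases hm.eq_or_lt with rfl | hm
      · have : (f j).coeff j = 1 := by
          have := hopt.monic.coeff_natDegree
          rwa [hopt.natDegree_eq] at this
        simp [this]
      · rw [coeff_sub, coeff_C_mul, coeff_eq_zero_of_degree_lt (hpj.trans_lt (by exact_mod_cast hm)),
          coeff_eq_zero_of_degree_lt (p := f j) (hfdeg.trans_lt (by exact_mod_cast hm))]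
        simp
    have hsum : p = (p - C (p.coeff j) * f j) + C (p.coeff j) * f j := by ring
    by_cases hr : p - C (p.coeff j) * f j = 0
    · exact ⟨j, by omega, l, by rw [hsum, hr, zero_add, hvf]⟩
    obtain ⟨i, hi, k, hk⟩ := ih (by omega) _ hr hrdeg
    -- The remainder and the multiple of `f j` have incongruent values, so the value of their sum is
    -- the smaller one.
    have hne : a i + n * k ≠ a j + n * l := fun h =>
      (hf i (by omega)).not_modEq hX hres hopt hi (by
        have := congrArg (· % n) h
        simpa [Nat.ModEq] using this)
    rcases hne.lt_or_gt with h | h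
    · refine ⟨i, by omega, k, ?_⟩
      rw [hsum, v.map_add_eq_of_lt_left, hk]
      rw [hk, hvf]; exact_mod_cast h
    · refine ⟨j, by omega, l, ?_⟩
      rw [hsum, v.map_add_eq_of_lt_right, hvf]
      rw [hk, hvf]; exact_mod_cast h

/-- The value semigroup of a valuation of `K[X, Y]` with residue field `K` has a superadditive
Apéry set. -/
theorem exists_superadditive_apery (hconst : ∀ z : K, z ≠ 0 → v (C (C z)) = 0) {n : ℕ}
    (hn : 0 < n) (hX : v (C X) = n)
    (hres : ∀ (p q : K[X][X]) (k : ℕ), v p = k → v q = k → ∃ z : K, (k : ℕ∞) < v (p - C (C z) * q))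
    (hfin : {k : ℕ | ∃ p, v p = k}ᶜ.Finite) :
    ∃ a : ℕ → ℕ, a 0 = 0 ∧ (∀ i < n, ∀ j < n, a i ≡ a j [MOD n] → i = j) ∧
      (∀ i j, i + j < n → a i + a j ≤ a (i + j)) ∧
      ∀ s : ℕ, (∃ p, v p = s) ↔ ∃ i < n, ∃ k, s = a i + n * k := by
  classical
  have hinj : ∀ (N : ℕ) (a : ℕ → ℕ) (f : ℕ → K[X][X]), (∀ j < N, IsOptimal v j (a j) (f j)) →
      ∀ i < N, ∀ j < N, a i ≡ a j [MOD n] → i = j := by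
    intro N a f hf i hi j hj h
    rcases lt_trichotomy i j with hij | hij | hij
    · exact absurd h ((hf i hi).not_modEq hX hres (hf j hj) hij)
    · exact hij
    · exact absurd h.symm ((hf j hj).not_modEq hX hres (hf i hi) hij)
  have hchoose : ∀ N : ℕ, (∀ j < N, ¬ Unbounded v j) → ∃ (a : ℕ → ℕ) (f : ℕ → K[X][X]),
      ∀ j < N, IsOptimal v j (a j) (f j) := by
    intro N hN
    have : ∀ j, ∃ a f, j < N → IsOptimal v j a f := by
      intro j
      by_cases hj : j < N
      · obtain ⟨a, f, h⟩ := exists_isOptimal (hN j hj)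
        exact ⟨a, f, fun _ => h⟩
      · exact ⟨0, 0, fun h => absurd h hj⟩
    choose a f h using this
    exact ⟨a, f, h⟩
  -- Optimal values have distinct residues modulo `n`, so boundedness fails in some degree at most
  -- `n`. The first such degree `N` turns out to be `n`.
  have hle : ∀ N : ℕ, (∀ j < N, ¬ Unbounded v j) → N ≤ n := by
    intro N hN
    obtain ⟨a, f, hf⟩ := hchoose N hN
    have := Finset.card_le_card_of_injOn (s := Finset.range N) (t := Finset.range n)
      (fun i => a i % n) (fun i _ => by simpa using Nat.mod_lt _ hn)
      (fun i hi j hj h => hinj N a f hf i (by simpa using hi) j (by simpa using hj) h)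
    simpa using this
  have hex : ∃ N, Unbounded v N := by
    by_contra h
    have := hle (n + 1) fun j _ hj => h ⟨j, hj⟩
    omega
  obtain ⟨N, hN, hmin⟩ : ∃ N, Unbounded v N ∧ ∀ j < N, ¬ Unbounded v j :=
    ⟨Nat.find hex, Nat.find_spec hex, fun _ => Nat.find_min hex⟩
  obtain ⟨a, f, hf⟩ := hchoose N hmin
  have hΓ : ∀ s : ℕ, (∃ p, v p = s) ↔ ∃ i < N, ∃ k, s = a i + n * k := by
    intro s
    constructor
    · rintro ⟨p, hp⟩
      -- Reducing `p` modulo a monic `h` of degree `N` with value above `s` does not change the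
      -- value of `p`.
      obtain ⟨h, hmon, hdeg, hv⟩ := hN s
      have hdiv := modByMonic_add_div p h
      have hval : v (p %ₘ h) = s := by
        rw [← hp]
        conv_rhs => rw [← hdiv]
        have hlt : v p < v (h * (p /ₘ h)) := by
          rw [v.map_mul, hp]; exact hv.trans_le le_self_add
        have h2 : p %ₘ h = p - h * (p /ₘ h) := eq_sub_of_add_eq hdiv
        rw [hdiv, h2]
        exact v.map_sub_eq_of_lt_left hlt
      obtain ⟨i, hi, k, hk⟩ := exists_value_of_degree_lt hconst hn hX hres hf N le_rfl (p %ₘ h)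
        (fun h0 => by rw [h0, v.map_zero] at hval; exact ENat.top_ne_natCast _ hval)
        (by rw [← hdeg, ← degree_eq_natDegree hmon.ne_zero]; exact degree_modByMonic_lt _ hmon)
      exact ⟨i, hi, k, by rw [hval] at hk; exact_mod_cast hk⟩
    · rintro ⟨i, hi, k, rfl⟩
      refine ⟨C X ^ k * f i, ?_⟩
      rw [v.map_mul, v.map_pow, hX, (hf i hi).value_eq, nsmul_eq_mul]
      push_cast
      ring
  have hNn : n ≤ N := by
    -- A value set with finite complement meets every residue class modulo `n`.
    have hsurj : ∀ r ∈ Finset.range n, ∃ i ∈ Finset.range N, a i % n = r := by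
      intro r hr
      rw [Finset.mem_range] at hr
      obtain ⟨t, ht⟩ : ∃ t : ℕ, r + n * t ∈ {k : ℕ | ∃ p, v p = k} := by
        by_contra hcon
        refine Set.infinite_of_injective_forall_mem (f := fun t : ℕ => r + n * t)
          (fun t t' h => ?_) (fun t => ?_) hfin
        · exact Nat.eq_of_mul_eq_mul_left hn (Nat.add_left_cancel h)
        · exact fun h => hcon ⟨t, h⟩
      obtain ⟨i, hi, k, hk⟩ := (hΓ _).1 ht
      refine ⟨i, Finset.mem_range.2 hi, ?_⟩
      have := congrArg (· % n) hk
      simp only [Nat.add_mul_mod_self_left, Nat.mod_eq_of_lt hr] at this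
      exact this.symm
    have := Finset.card_le_card_of_surjOn (s := Finset.range N) (t := Finset.range n)
      (fun i => a i % n) (fun r hr => by simpa using hsurj r (by simpa using hr))
    simpa using this
  obtain rfl : N = n := le_antisymm (hle N hmin) hNn
  exact ⟨a, (hf 0 hn).eq_zero, hinj N a f hf,
    fun i j hij => (hf i (by omega)).add_le (hf j (by omega)) (hf _ hij), hΓ⟩

end Approximants

/-! ### The order of vanishing along a curve as a valuation -/

open Asymptotics in
-- If the order were `j < k`, then `t ^ j = O(h)` and `h = o(t ^ j)`, which is absurd.
theorem le_analyticOrderAt_of_isBigO {h : ℂ → ℂ} (hh : AnalyticAt ℂ h 0) {k : ℕ}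
    (hO : h =O[𝓝 0] fun t : ℂ => t ^ k) : (k : ℕ∞) ≤ analyticOrderAt h 0 := by
  by_contra hlt
  obtain ⟨j, hj, hjk⟩ := (show ∃ j : ℕ, analyticOrderAt h 0 = j ∧ j < k by
    obtain ⟨j, hj⟩ := ENat.ne_top_iff_exists.1 (not_le.1 hlt).ne_top
    exact ⟨j, hj.symm, by rw [← hj] at hlt; exact_mod_cast not_le.1 hlt⟩)
  obtain ⟨g, hg, hg0, he⟩ := hh.analyticOrderAt_eq_natCast.1 hj
  have h1 : h =o[𝓝 0] fun t : ℂ => t ^ j := hO.trans_isLittleO (isLittleO_pow_pow hjk)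
  have h2 : (fun t : ℂ => t ^ j) =O[𝓝 0] h := by
    have h3 : (fun t => (g t)⁻¹) =O[𝓝 0] fun _ => (1 : ℂ) :=
      (hg.continuousAt.inv₀ hg0).tendsto.isBigO_one ℂ
    have h4 := h3.mul (isBigO_refl h (𝓝 0))
    simp only [one_mul] at h4
    refine (Filter.EventuallyEq.isBigO ?_).trans h4
    filter_upwards [he, hg.continuousAt.eventually_ne hg0] with t ht ht0
    rw [ht, sub_zero, smul_eq_mul]
    field_simp
  refine isLittleO_irrefl ?_ (h2.trans_isLittleO h1)
  have h5 : ∃ᶠ t : ℂ in 𝓝[≠] 0, t ^ j ≠ 0 := by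
    refine Filter.Eventually.frequently ?_
    filter_upwards [self_mem_nhdsWithin] with t ht using pow_ne_zero _ ht
  exact h5.filter_mono nhdsWithin_le_nhds

section PolynomialPullback

open Polynomial

/-- The pullback of bivariate polynomials along `t ↦ (x t, y t)`. -/
noncomputable def pullback (x y : ℂ → ℂ) : ℂ[X][X] →+* (ℂ → ℂ) :=
  RingHom.pi fun t => evalEvalRingHom (x t) (y t)

theorem pullback_apply (x y : ℂ → ℂ) (P : ℂ[X][X]) (t : ℂ) :
    pullback x y P t = P.evalEval (x t) (y t) := rfl

theorem analyticAt_evalEval {E : Type*} [NormedAddCommGroup E] [NormedSpace ℂ E] {x y : E → ℂ}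
    {e : E} (hx : AnalyticAt ℂ x e) (hy : AnalyticAt ℂ y e) (P : ℂ[X][X]) :
    AnalyticAt ℂ (fun t => P.evalEval (x t) (y t)) e := by
  have h : (fun t => P.evalEval (x t) (y t)) = fun t => ∑ i ∈ Finset.range (P.natDegree + 1),
      (∑ k ∈ Finset.range ((P.coeff i).natDegree + 1), (P.coeff i).coeff k * x t ^ k) * y t ^ i := by
    ext t
    rw [← congrFun (eval₂_evalRingHom (x t)) (y t), eval₂_eq_sum_range]
    simp only [coe_evalRingHom, eval_eq_sum_range]
  rw [h]
  refine Finset.analyticAt_fun_sum _ fun i _ => AnalyticAt.mul ?_ (hy.pow i)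
  exact Finset.analyticAt_fun_sum _ fun k _ => analyticAt_const.mul (hx.pow k)

theorem analyticAt_pullback {x y : ℂ → ℂ} (hx : AnalyticAt ℂ x 0) (hy : AnalyticAt ℂ y 0)
    (P : ℂ[X][X]) : AnalyticAt ℂ (pullback x y P) 0 :=
  analyticAt_evalEval hx hy P

/-- The order of vanishing at `t = 0` along `(x, y)` as a valuation of `ℂ[X][Y]`. -/
noncomputable def curveValuation {x y : ℂ → ℂ} (hx : AnalyticAt ℂ x 0) (hy : AnalyticAt ℂ y 0) :
    AddValuation ℂ[X][X] ℕ∞ :=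
  AddValuation.of (fun P => analyticOrderAt (pullback x y P) 0)
    (by rw [map_zero, analyticOrderAt_eq_top]; simp)
    (by rw [map_one, analyticOrderAt_eq_zero]; simp)
    (fun P Q => by rw [map_add]; exact le_analyticOrderAt_add)
    (fun P Q => by
      rw [map_mul]
      exact analyticOrderAt_mul (analyticAt_pullback hx hy P) (analyticAt_pullback hx hy Q))

variable {x y : ℂ → ℂ} (hx : AnalyticAt ℂ x 0) (hy : AnalyticAt ℂ y 0)

theorem curveValuation_apply (P : ℂ[X][X]) :
    curveValuation hx hy P = analyticOrderAt (pullback x y P) 0 := rfl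

theorem curveValuation_const {z : ℂ} (hz : z ≠ 0) : curveValuation hx hy (C (C z)) = 0 := by
  rw [curveValuation_apply, analyticOrderAt_eq_zero]
  right
  simpa [pullback_apply] using hz

theorem curveValuation_C_X : curveValuation hx hy (C X) = analyticOrderAt x 0 := by
  rw [curveValuation_apply]
  congr 1
  ext t
  simp [pullback_apply, evalEval_C]

theorem curveValuation_X : curveValuation hx hy X = analyticOrderAt y 0 := by
  rw [curveValuation_apply]
  congr 1
  ext t
  simp [pullback_apply]

/-- Take `z` to be the ratio of the leading coefficients in `t`, so that the terms of order `k`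
cancel. -/
theorem curveValuation_residue (P Q : ℂ[X][X]) (k : ℕ) (hP : curveValuation hx hy P = k)
    (hQ : curveValuation hx hy Q = k) :
    ∃ z : ℂ, (k : ℕ∞) < curveValuation hx hy (P - C (C z) * Q) := by
  rw [curveValuation_apply] at hP hQ
  obtain ⟨g, hg, hg0, hge⟩ := (analyticAt_pullback hx hy P).analyticOrderAt_eq_natCast.1 hP
  obtain ⟨h, hh, hh0, hhe⟩ := (analyticAt_pullback hx hy Q).analyticOrderAt_eq_natCast.1 hQ
  refine ⟨g 0 / h 0, ?_⟩
  have hd : AnalyticAt ℂ (fun t => g t - g 0 / h 0 * h t) 0 := by fun_prop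
  have he : pullback x y (P - C (C (g 0 / h 0)) * Q) =ᶠ[𝓝 0]
      (fun t => t ^ k) * fun t => g t - g 0 / h 0 * h t := by
    filter_upwards [hge, hhe] with t h1 h2
    rw [map_sub, map_mul, Pi.sub_apply, Pi.mul_apply, h1, h2, pullback_apply]
    simp
    ring
  have hk : analyticOrderAt (fun t : ℂ => t ^ k) 0 = k := by
    have := analyticOrderAt_pow (𝕜 := ℂ) (f := id) (z₀ := 0) analyticAt_id k
    rwa [analyticOrderAt_id, nsmul_one] at this
  rw [curveValuation_apply, analyticOrderAt_congr he, analyticOrderAt_mul (by fun_prop) hd, hk]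
  have h1 : analyticOrderAt (fun t => g t - g 0 / h 0 * h t) 0 ≠ 0 := by
    rw [hd.analyticOrderAt_ne_zero]
    field_simp
    ring
  exact (ENat.add_one_le_iff (ENat.natCast_ne_top k)).1
    (add_le_add_right (Order.one_le_iff_ne_zero.2 h1) _)

end PolynomialPullback

/-! ### From analytic functions to polynomials -/

section Truncation

open Polynomial

variable {d : ℕ} {c : ℂ → (Fin d → ℂ)}

/-- Along a curve with two coordinates, a multilinear form is pulled back to a bivariate
polynomial. -/
theorem multilinear_mem_range_pullback {i j : Fin d} (hij : ∀ l, l = i ∨ l = j) {n : ℕ}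
    (f : ContinuousMultilinearMap ℂ (fun _ : Fin n => Fin d → ℂ) ℂ) :
    (fun t => f fun _ => c t) ∈ (pullback (fun t => c t i) (fun t => c t j)).range := by
  have hcoord : ∀ l, (fun t => c t l) ∈ (pullback (fun t => c t i) (fun t => c t j)).range := by
    intro l
    rcases hij l with rfl | rfl
    · exact ⟨C X, by ext t; simp [pullback_apply, evalEval_C]⟩
    · exact ⟨X, by ext t; simp [pullback_apply]⟩
  have hconst : ∀ z : ℂ, (fun _ => z) ∈ (pullback (fun t => c t i) (fun t => c t j)).range :=
    fun z => ⟨C (C z), by ext t; simp [pullback_apply]⟩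
  -- Expand `c t` in the standard basis and use multilinearity.
  have hf : (fun t => f fun _ => c t) = ∑ r : Fin n → Fin d,
      (∏ k, fun t => c t (r k)) * fun _ => f fun k => Pi.single (r k) 1 := by
    ext t
    have hc : c t = ∑ l, c t l • (Pi.single l 1 : Fin d → ℂ) := pi_eq_sum_univ' (c t)
    conv_lhs => rw [hc]
    rw [f.map_sum]
    simp only [f.map_smul_univ, Finset.sum_apply, Pi.mul_apply, Finset.prod_apply, smul_eq_mul]
  rw [hf]
  exact sum_mem fun r _ => mul_mem (prod_mem fun k _ => hcoord _) (hconst _)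

open Asymptotics in
/-- Up to any order, an analytic function on a plane curve is the pullback of a polynomial. -/
theorem exists_polynomial_approx {i j : Fin d} (hij : ∀ l, l = i ∨ l = j)
    (hc : AnalyticAt ℂ c 0) (hc0 : c 0 = 0) {p : (Fin d → ℂ) → ℂ} (hp : AnalyticAt ℂ p 0) (k : ℕ) :
    ∃ P : ℂ[X][X], (k : ℕ∞) ≤
      analyticOrderAt (p ∘ c - pullback (fun t => c t i) (fun t => c t j) P) 0 := by
  obtain ⟨q, hq⟩ := hp
  have hmem : (fun t => q.partialSum k (c t)) ∈
      (pullback (fun t => c t i) (fun t => c t j)).range := by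
    have : (fun t => q.partialSum k (c t)) = ∑ l ∈ Finset.range k, fun t => q l fun _ => c t := by
      ext t
      simp [FormalMultilinearSeries.partialSum]
    rw [this]
    exact sum_mem fun l _ => multilinear_mem_range_pullback hij (q l)
  obtain ⟨P, hP⟩ := hmem
  have hci := analyticAt_pi_iff.1 hc
  refine ⟨P, le_analyticOrderAt_of_isBigO ?_ ?_⟩
  · refine AnalyticAt.sub ?_ (analyticAt_pullback (hci i) (hci j) P)
    exact AnalyticAt.comp (by rw [hc0]; exact hq.analyticAt) hc
  -- The Taylor remainder is `O(‖z‖ ^ k)`, and `c t = O(t)` because `c 0 = 0`.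
  · have h1 := hq.isBigO_sub_partialSum_pow k
    have h2 : Filter.Tendsto c (𝓝 0) (𝓝 0) := by
      have := hc.continuousAt.tendsto
      rwa [hc0] at this
    have h3 := h1.comp_tendsto h2
    have h4 : c =O[𝓝 0] fun t : ℂ => t := by
      have := hc.differentiableAt.isBigO_sub
      simpa [hc0] using this
    rw [hP]
    refine (IsBigO.trans (h3.congr_left fun t => ?_) (h4.norm_left.pow k))
    simp

/-- The semigroup of a plane curve is the set of finite values of the order valuation on
polynomials. -/
theorem mem_semigroupOfCurve_iff {i j : Fin d} (hij : ∀ l, l = i ∨ l = j)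
    (hc : AnalyticAt ℂ c 0) (hc0 : c 0 = 0) (hi : AnalyticAt ℂ (fun t => c t i) 0)
    (hj : AnalyticAt ℂ (fun t => c t j) 0) (s : ℕ) :
    s ∈ semigroupOfCurve c ↔ ∃ P, curveValuation hi hj P = s := by
  constructor
  · rintro ⟨p, hp, hs⟩
    obtain ⟨P, hP⟩ := exists_polynomial_approx hij hc hc0 hp (s + 1)
    refine ⟨P, ?_⟩
    rw [curveValuation_apply, ← hs]
    have hlt : analyticOrderAt (p ∘ c) 0 <
        analyticOrderAt (-(p ∘ c - pullback (fun t => c t i) (fun t => c t j) P)) 0 := by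
      rw [analyticOrderAt_neg, hs]
      exact lt_of_lt_of_le (by exact_mod_cast Nat.lt_succ_self s) hP
    rw [← analyticOrderAt_add_eq_left_of_lt hlt]
    congr 1
    abel
  · rintro ⟨P, hP⟩
    refine ⟨fun z => P.evalEval (z i) (z j), ?_, hP⟩
    exact analyticAt_evalEval (analyticAt_pi_iff.1 analyticAt_id i)
      (analyticAt_pi_iff.1 analyticAt_id j) P

end Truncation

/-! ### Choosing a coordinate of minimal order -/

open Polynomial in
/-- One of the coordinates of a plane curve has the smallest positive order. -/
theorem exists_coordinate_le {x y : ℂ → ℂ} (hx : AnalyticAt ℂ x 0) (hy : AnalyticAt ℂ y 0)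
    {m : ℕ} (hm : 0 < m) {P : ℂ[X][X]} (hP : curveValuation hx hy P = m) :
    analyticOrderAt x 0 ≤ m ∨ analyticOrderAt y 0 ≤ m := by
  by_contra! h
  set v := curveValuation hx hy with hv
  -- Split off the constant term. If both coordinates had order above `m`, the value of `P` would be
  -- `0` or exceed `m`.
  have hdec : P = C (C ((P.coeff 0).coeff 0)) + (C X * C (P.coeff 0).divX + X * P.divX) := by
    conv_lhs => rw [← X_mul_divX_add P, ← X_mul_divX_add (P.coeff 0)]
    simp only [C_add, C_mul]
    ring
  have hgt : (m : ℕ∞) < v (C X * C (P.coeff 0).divX + X * P.divX) := by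
    apply v.map_lt_add
    · rw [v.map_mul, hv, curveValuation_C_X]
      exact h.1.trans_le le_self_add
    · rw [v.map_mul, hv, curveValuation_X]
      exact h.2.trans_le le_self_add
  by_cases hz : (P.coeff 0).coeff 0 = 0
  · rw [hz, C_0, C_0, zero_add] at hdec
    rw [← hdec, hP] at hgt
    exact lt_irrefl _ hgt
  · have h0 := curveValuation_const hx hy hz
    rw [hdec, v.map_add_eq_of_lt_left (by rw [h0]; exact zero_le.trans_lt hgt), h0] at hP
    exact hm.ne (by exact_mod_cast hP)

open Polynomial in
/-- If the first of two coordinates has the order `m`, the semigroup of the curve has at most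
`1 + Ω m` generators. -/
theorem exists_generators_of_order_eq {d : ℕ} {c : ℂ → (Fin d → ℂ)} {i j : Fin d}
    (hij : ∀ l, l = i ∨ l = j) (hc : AnalyticAt ℂ c 0) (hc0 : c 0 = 0) {S : AddSubmonoid ℕ}
    (hS : IsNumericalSemigroup S) (hcS : semigroupOfCurve c = (S : Set ℕ)) {m : ℕ} (hm : 0 < m)
    (hi : analyticOrderAt (fun t => c t i) 0 = m) :
    ∃ B : Finset ℕ, AddSubmonoid.closure (B : Set ℕ) = S ∧
      B.card ≤ 1 + ArithmeticFunction.cardFactors m := by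
  have hx := analyticAt_pi_iff.1 hc i
  have hy := analyticAt_pi_iff.1 hc j
  have hmem : ∀ s, s ∈ S ↔ ∃ P, curveValuation hx hy P = s := fun s => by
    rw [← mem_semigroupOfCurve_iff hij hc hc0 hx hy, hcS, SetLike.mem_coe]
  have hfin : {k : ℕ | ∃ P, curveValuation hx hy P = k}ᶜ.Finite := by
    have : {k : ℕ | ∃ P, curveValuation hx hy P = k} = S := by
      ext k
      exact (hmem k).symm
    rw [this]
    exact hS
  obtain ⟨a, ha0, hinj, hsup, ha⟩ := exists_superadditive_apery (v := curveValuation hx hy)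
    (fun z hz => curveValuation_const hx hy hz) hm ((curveValuation_C_X hx hy).trans hi)
    (curveValuation_residue hx hy) hfin
  exact exists_generators_of_superadditive S hm ha0 hinj hsup fun s => (hmem s).trans (ha s)

theorem exists_generators_of_plane_curve {S : AddSubmonoid ℕ} (hS : IsNumericalSemigroup S)
    (hreal : IsRealizedInDim S 2) {m : ℕ} (hmS : m ∈ S) (hm : 0 < m)
    (hmin : ∀ s ∈ S, s ≠ 0 → m ≤ s) :
    ∃ B : Finset ℕ, AddSubmonoid.closure (B : Set ℕ) = S ∧
      B.card ≤ 1 + ArithmeticFunction.cardFactors m := by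
  obtain ⟨c, ⟨hc, hc0, -⟩, hcS⟩ := hreal
  have hcoord := analyticAt_pi_iff.1 hc
  have hij : ∀ l : Fin 2, l = 0 ∨ l = 1 := by decide
  -- The order of a coordinate lies in `S` and is nonzero since `c 0 = 0`, so it cannot be below
  -- `m`.
  have hge : ∀ l, analyticOrderAt (fun t => c t l) 0 ≤ m →
      analyticOrderAt (fun t => c t l) 0 = m := by
    intro l hl
    obtain ⟨s, hs⟩ := ENat.ne_top_iff_exists.1 (hl.trans_lt (ENat.natCast_lt_top m)).ne
    have hsS : s ∈ S := by
      rw [← SetLike.mem_coe, ← hcS]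
      exact ⟨fun z => z l, analyticAt_pi_iff.1 analyticAt_id l, hs.symm⟩
    have hs0 : s ≠ 0 := by
      rintro rfl
      exact (hcoord l).analyticOrderAt_ne_zero.2 (by rw [hc0]; rfl) hs.symm
    rw [← hs]
    exact le_antisymm (hs ▸ hl) (by exact_mod_cast hmin s hsS hs0)
  rw [← SetLike.mem_coe, ← hcS,
    mem_semigroupOfCurve_iff hij hc hc0 (hcoord 0) (hcoord 1)] at hmS
  obtain ⟨P, hP⟩ := hmS
  rcases exists_coordinate_le (hcoord 0) (hcoord 1) hm hP with h | h
  · exact exists_generators_of_order_eq hij hc hc0 hS hcS hm (hge 0 h)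
  · exact exists_generators_of_order_eq (fun l => (hij l).symm) hc hc0 hS hcS hm (hge 1 h)

/-! ### Minimal generating sets and the conclusion -/

theorem IsMinimalGeneratingSet.embeddingDim_eq {S : AddSubmonoid ℕ} {A : Finset ℕ}
    (hA : IsMinimalGeneratingSet S A) : embeddingDim S = A.card := by
  have : {e : ℕ | ∃ A : Finset ℕ, IsMinimalGeneratingSet S A ∧ A.card = e} = {A.card} := by
    ext e
    constructor
    · rintro ⟨B, hB, rfl⟩
      exact le_antisymm (hB.2 A hA.1) (hA.2 B hB.1)
    · rintro rfl
      exact ⟨A, hA, rfl⟩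
  rw [embeddingDim, this, csInf_singleton]

theorem IsMinimalGeneratingSet.zero_notMem {S : AddSubmonoid ℕ} {A : Finset ℕ}
    (hA : IsMinimalGeneratingSet S A) : 0 ∉ A := by
  intro h
  have hcl : AddSubmonoid.closure ((A.erase 0 : Finset ℕ) : Set ℕ) = S := by
    rw [← hA.1]
    refine le_antisymm (AddSubmonoid.closure_mono (by simp)) ?_
    rw [AddSubmonoid.closure_le]
    intro x hx
    by_cases hx0 : x = 0
    · rw [hx0]; exact zero_mem _
    · exact AddSubmonoid.subset_closure (by simpa [hx0] using hx)
  have := hA.2 _ hcl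
  have := Finset.card_erase_lt_of_mem h
  omega

/-- The nonzero elements of a submonoid of `ℕ` are bounded below by its generators. -/
theorem le_of_mem_closure {A : Set ℕ} {m : ℕ} (hA : ∀ x ∈ A, m ≤ x) {s : ℕ}
    (hs : s ∈ AddSubmonoid.closure A) : s ≠ 0 → m ≤ s := by
  induction hs using AddSubmonoid.closure_induction with
  | mem x hx => exact fun _ => hA x hx
  | zero => exact fun h => absurd rfl h
  | add x y _ _ ihx ihy => omega

end CurveSemigroup

theorem mainTheorem2 (S : AddSubmonoid ℕ) (hS : CurveSemigroup.IsNumericalSemigroup S)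
    (g : ℕ) (b : Fin (g + 1) → ℕ) (hb : StrictMono b)
    (hgen : CurveSemigroup.IsMinimalGeneratingSet S (Finset.univ.image b))
    (hplanar : CurveSemigroup.IsPlanar S) :
    CurveSemigroup.multiplicity S = b 0 ∧
      CurveSemigroup.embeddingDim S = g + 1 ∧
      CurveSemigroup.embeddingDim S ≤
        1 + ArithmeticFunction.cardFactors (CurveSemigroup.multiplicity S) := by
  have hb0S : b 0 ∈ S := by
    rw [← hgen.1]
    exact AddSubmonoid.subset_closure (by simp)
  have hb0 : b 0 ≠ 0 := fun h => hgen.zero_notMem (by rw [← h]; simp)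
  have hmin : ∀ s ∈ S, s ≠ 0 → b 0 ≤ s := by
    intro s hs
    rw [← hgen.1] at hs
    refine CurveSemigroup.le_of_mem_closure ?_ hs
    simp only [Finset.coe_image, Finset.coe_univ, Set.image_univ, Set.mem_range]
    rintro _ ⟨i, rfl⟩
    exact hb.monotone (Fin.zero_le i)
  have hmul : CurveSemigroup.multiplicity S = b 0 :=
    le_antisymm (Nat.sInf_le ⟨hb0S, hb0⟩)
      (le_csInf ⟨b 0, hb0S, hb0⟩ fun s hs => hmin s hs.1 hs.2)
  have hreal : CurveSemigroup.IsRealizedInDim S 2 := by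
    -- An infimum equal to `2` is not the default value `0`, so it is attained.
    have hmem := Nat.sInf_mem (Nat.nonempty_of_sInf_eq_succ hplanar)
    change sInf {d : ℕ | CurveSemigroup.IsRealizedInDim S d} = 2 at hplanar
    rwa [hplanar] at hmem
  obtain ⟨B, hB, hcard⟩ := CurveSemigroup.exists_generators_of_plane_curve hS hreal hb0S
    (Nat.pos_of_ne_zero hb0) hmin
  refine ⟨hmul, ?_, ?_⟩
  · rw [hgen.embeddingDim_eq, Finset.card_image_of_injective _ hb.injective, Finset.card_fin]
  · rw [hgen.embeddingDim_eq, hmul]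
    exact (hgen.2 B hB).trans hcard
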